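/- **Conventions.** A digraph $\Gamma$ is a set $V\Gamma$ of vertices with a set of arcs $(u,v)\in V\Gamma\times V\Gamma$ such that if $(u,v)$ is an arc then $(v,u)$ is not. It is connected if its underlying undirected graph is connected. An $s$-arc is a sequence $(v_0,\dots,v_s)$ of vertices with each $(v_i,v_{i+1})$ an arc. For $G\leq\mathrm{Aut}(\Gamma)$, $\Gamma$ is $(G,s)$-arc-transitive if $G$ is transitive on $s$-arcs, and it is $G$-vertex-bi-quasiprimitive if $G$ is transitive on $V\Gamma$, every nontrivial normal subgroup of $G$ has at most two orbits on $V\Gamma$, and some normal subgroup has exactly two. A permutation group is quasiprimitive if it is transitive and each of its nontrivial normal subgroups is transitive. Permutations act on the right. **Proposition.** Let $\Gamma$ be a finite connected $G$-vertex-bi-quasiprimitive, $(G,s)$-arc-transitive digraph with $G\leq\mathrm{Aut}(\Gamma)$ and $s\geq 2$, and suppose that $\Gamma$ is not a directed cycle. Let $G^+\leq G$ be a subgroup of index $2$ with two orbits $\Delta,\Delta'$ on $V\Gamma$, and let $H\leq\mathrm{Sym}(\Delta)$ be the permutation group induced by $G^+$ on $\Delta$. Given a labelling $\Delta'=\{\delta'\mid\delta\in\Delta\}$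 (that is, a bijection $\delta\mapsto\delta'$ from $\Delta$ to $\Delta'$), write $(h,k)$, for $h,k\in\mathrm{Sym}(\Delta)$, for the permutation $\delta\mapsto\delta^h$, $\delta'\mapsto(\delta^k)'$ of $V\Gamma$, write $(1,2)$ for the permutation interchanging $\delta$ and $\delta'$ for every $\delta\in\Delta$, and put $H\wr\mathrm{Sym}(2)=(H\times H)\rtimes\langle(1,2)\rangle\leq\mathrm{Sym}(V\Gamma)$. There are a labelling and an element $x\in H$ such that $$G\leq H\wr\mathrm{Sym}(2)\quad\text{and}\quad g:=(x,1)(1,2)\in G.$$ For every such labelling and every such $x$, there is $\varphi\in\mathrm{Aut}(H)$ such that $$G^+=\mathrm{Diag}_\varphi(H\times H)=\{(h,h^\varphi)\mid h\in H\}\quad\text{and}\quad \varphi^2=\iota_x,$$ where $\iota_x\in\mathrm{Inn}(H)$ is the map $y\mapsto x^{-1}yx$, and, moreover, one of the following holds: 1. (case (a)(i) of Praeger's structure theorem for bi-quasiprimitive groups) $H$ is quasiprimitive on $\Delta$, and $g$ does not centralise $G^+$; 2. (case (c) of that theorem) $H$ has a minimal normal subgroup $R$ which is intransitive on $\Delta$,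 such that $R^\varphi\neq R$, the subgroup $M:=RR^\varphi$ of $H$ is the internal direct product $R\times R^\varphi$, is $\varphi$-invariant and is transitive on $\Delta$, and $N:=\mathrm{Diag}_\varphi(M\times M)=\{(h,h^\varphi)\mid h\in M\}$ is a minimal normal subgroup of $G$. -/

import Mathlib

namespace BiQuasi

/-- Digraphs here have no arc together with its reverse; in particular they have no loops. -/
def IsOriented {V : Type*} (Γ : Digraph V) : Prop :=
  ∀ u v, Γ.Adj u v → ¬ Γ.Adj v u

/-- `Γ` is connected: its underlying undirected graph is connected. -/
def IsConnected {V : Type*} (Γ : Digraph V) : Prop :=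
  Γ.toSimpleGraphInclusive.Connected

/-- `Γ` is isomorphic to the directed cycle of length `r` for some `r ≥ 3`. -/
def IsDirectedCycle {V : Type*} (Γ : Digraph V) : Prop :=
  ∃ r : ℕ, 3 ≤ r ∧ ∃ e : V ≃ ZMod r, ∀ u v, Γ.Adj u v ↔ e v = e u + 1

/-- The automorphism group of a digraph, as a permutation group on the vertices. -/
def autGroup {V : Type*} (Γ : Digraph V) : Subgroup (Equiv.Perm V) where
  carrier := {g | ∀ u v, Γ.Adj (g u) (g v) ↔ Γ.Adj u v}
  one_mem' := by intro u v; simp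
  mul_mem' := by
    intro a b ha hb u v
    rw [Equiv.Perm.mul_apply, Equiv.Perm.mul_apply, ha, hb]
  inv_mem' := by
    intro a ha u v
    rw [← ha]
    simp

/-- An `s`-arc: a sequence of `s + 1` vertices with consecutive ones joined by an arc. -/
def IsArc {V : Type*} (Γ : Digraph V) (s : ℕ) (v : Fin (s + 1) → V) : Prop :=
  ∀ i : Fin s, Γ.Adj (v i.castSucc) (v i.succ)

/-- `G` is transitive on the set of `s`-arcs of `Γ`. -/
def IsArcTransitive {V : Type*} (Γ : Digraph V) (G : Subgroup (Equiv.Perm V)) (s : ℕ) : Prop :=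
  ∀ v w : Fin (s + 1) → V, IsArc Γ s v → IsArc Γ s w → ∃ g ∈ G, ∀ i, g (v i) = w i

/-- The number of orbits of a group acting on `V`. -/
noncomputable def numOrbits (K V : Type*) [Group K] [MulAction K V] : ℕ :=
  Nat.card (MulAction.orbitRel.Quotient K V)

/-- A (transitive) permutation group is bi-quasiprimitive if every nontrivial normal subgroup has
at most two orbits and some normal subgroup has exactly two orbits. (Orbits of a normal subgroup of
a transitive group automatically have equal length.) -/
structure IsBiQuasiprimitive {V : Type*} (G : Subgroup (Equiv.Perm V)) : Prop where
  transitive : MulAction.IsPretransitive G V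
  le_two : ∀ N : Subgroup G, N.Normal → N ≠ ⊥ → numOrbits N V ≤ 2
  exists_two : ∃ N : Subgroup G, N.Normal ∧ numOrbits N V = 2

/-- A permutation group on `D` is quasiprimitive if it is transitive and every nontrivial normal
subgroup is transitive. -/
structure IsQuasiprimitive {D : Type*} (H : Subgroup (Equiv.Perm D)) : Prop where
  transitive : MulAction.IsPretransitive H D
  of_normal : ∀ N : Subgroup H, N.Normal → N ≠ ⊥ → MulAction.IsPretransitive N D

/-- Minimal normal subgroups: minimal among the nontrivial normal subgroups. -/
def IsMinimalNormal {K : Type*} [Group K] (N : Subgroup K) : Prop :=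
  Minimal (fun L : Subgroup K => L.Normal ∧ L ≠ ⊥) N

/-- The orbits of `K` on `V` are precisely the two distinct sets `Δ` and `Δ'`. -/
def HasTwoOrbits {V : Type*} (K : Subgroup (Equiv.Perm V)) (Δ Δ' : Set V) : Prop :=
  Δ ≠ Δ' ∧ Set.range (fun v : V => MulAction.orbit K v) = {Δ, Δ'}

/-- The permutation group induced on the set `Δ` by the elements of `K` (preserving `Δ`). -/
def inducedOn {V : Type*} (K : Subgroup (Equiv.Perm V)) (Δ : Set V) :
    Subgroup (Equiv.Perm Δ) where
  carrier := {h | ∃ k ∈ K, ∀ δ : Δ, ((h δ : Δ) : V) = k δ}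
  one_mem' := ⟨1, K.one_mem, fun _ => rfl⟩
  mul_mem' := by
    rintro a b ⟨k, hk, hak⟩ ⟨l, hl, hbl⟩
    refine ⟨k * l, K.mul_mem hk hl, fun δ => ?_⟩
    rw [Equiv.Perm.mul_apply, Equiv.Perm.mul_apply, hak, hbl]
  inv_mem' := by
    rintro a ⟨k, hk, hak⟩
    refine ⟨k⁻¹, K.inv_mem hk, fun δ => ?_⟩
    rw [Equiv.Perm.eq_inv_iff_eq, ← hak]
    simp

/-- A labelling `Δ' = {δ' | δ ∈ Δ}` of the second part by the first: a bijection from two copies of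
`Δ` onto `V` which is the identity on the first copy and maps the second copy, by `δ ↦ δ'`,
into (hence onto) `Δ'`. -/
structure Labelling {V : Type*} (Δ Δ' : Set V) where
  toEquiv : Δ ⊕ Δ ≃ V
  map_inl : ∀ δ : Δ, toEquiv (Sum.inl δ) = δ
  map_inr : ∀ δ : Δ, toEquiv (Sum.inr δ) ∈ Δ'

namespace Labelling

variable {V : Type*} {Δ Δ' : Set V} (e : Labelling Δ Δ')

/-- The permutation `(h, k)` of `V`, mapping `δ` to `h δ` and `δ'` to `(k δ)'`. -/
def pair : Equiv.Perm Δ × Equiv.Perm Δ →* Equiv.Perm V where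
  toFun p := e.toEquiv.permCongr (Equiv.Perm.sumCongrHom Δ Δ p)
  map_one' := by ext v; simp
  map_mul' p q := by
    ext v
    simp only [map_mul, Equiv.permCongr_apply, Equiv.Perm.mul_apply, Equiv.symm_apply_apply]

/-- The standard interchanging permutation `(1,2)`, mapping `δ` to `δ'` and `δ'` to `δ`. -/
def swap : Equiv.Perm V :=
  e.toEquiv.permCongr (Equiv.sumComm Δ Δ)

/-- The wreath product `H ≀ Sym(2) = (H × H) ⋊ ⟨(1,2)⟩` as a permutation group on `V`. -/
def wreath (H : Subgroup (Equiv.Perm Δ)) : Subgroup (Equiv.Perm V) :=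
  (H.prod H).map e.pair ⊔ Subgroup.zpowers e.swap

/-- The element `(x,1)(1,2)` in right-action notation, so `(x,1)` is applied first; composition of
permutations in Mathlib is from right to left. For the same reason the inner automorphism
`y ↦ x⁻¹yx` of right-action notation is `MulAut.conj x : y ↦ x * y * x⁻¹` here. -/
def twistedSwap (x : Equiv.Perm Δ) : Equiv.Perm V :=
  e.swap * e.pair (x, 1)

/-- The homomorphism `h ↦ (h, h ^ φ)` from `H` to the base group `H × H`, inside `Sym(V)`. -/
def diagHom {H : Subgroup (Equiv.Perm Δ)} (φ : MulAut H) : H →* Equiv.Perm V :=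
  e.pair.comp (H.subtype.prod (H.subtype.comp φ.toMonoidHom))

/-- `Diag_φ(K × K) = {(h, h ^ φ) | h ∈ K}`, for a subgroup `K` of `H`. -/
def diag {H : Subgroup (Equiv.Perm Δ)} (φ : MulAut H) (K : Subgroup H) :
    Subgroup (Equiv.Perm V) :=
  K.map (e.diagHom φ)

/-- The standing normalisation for `G` and its index `2` subgroup inducing `H` on `Δ`:
`G ≤ H ≀ Sym(2)` and `(x,1)(1,2) ∈ G` with `x ∈ H`. -/
structure IsStandard (G : Subgroup (Equiv.Perm V)) (H : Subgroup (Equiv.Perm Δ)) (x : H) :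
    Prop where
  le_wreath : G ≤ e.wreath H
  mem : e.twistedSwap (x : Equiv.Perm Δ) ∈ G

/-- The first structural case: `H` is quasiprimitive on `Δ` and `g = (x,1)(1,2)` does not
centralise the index `2` subgroup `Gp`. -/
def QuasiprimitiveCase (Gp : Subgroup (Equiv.Perm V)) (H : Subgroup (Equiv.Perm Δ)) (x : H) :
    Prop :=
  IsQuasiprimitive H ∧
    ¬ ∀ u ∈ Gp, e.twistedSwap (x : Equiv.Perm Δ) * u = u * e.twistedSwap (x : Equiv.Perm Δ)

/-- The second structural case: `H` has a minimal normal subgroup `R`, intransitive on `Δ`, with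
`R ^ φ ≠ R`, such that `M = R R ^ φ` is the (internal) direct product of `R` and `R ^ φ` and is
transitive on `Δ`, and `N = Diag_φ(M × M)` is a minimal normal subgroup of `G`. -/
def IntransitiveCase (G : Subgroup (Equiv.Perm V)) (H : Subgroup (Equiv.Perm Δ))
    (φ : MulAut H) : Prop :=
  ∃ R M : Subgroup H,
    IsMinimalNormal R ∧ ¬ MulAction.IsPretransitive R Δ ∧
    R.map φ.toMonoidHom ≠ R ∧
    Disjoint R (R.map φ.toMonoidHom) ∧ M = R ⊔ R.map φ.toMonoidHom ∧
    M.map φ.toMonoidHom = M ∧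
    MulAction.IsPretransitive M Δ ∧
    e.diag φ M ≤ G ∧ IsMinimalNormal ((e.diag φ M).subgroupOf G)

end Labelling

end BiQuasi

/-!
Since `Γ` is not a directed cycle, its out-valencies are at least two (`exists_adj_ne`), so for every
`2`-arc `(v, w, u)` some element of `G` fixes `v` and `w` and moves `u`. The elements of `Gp` are
pairs `(h, k)` with respect to the labelling, and conjugation by `t = (x, 1)(1, 2)` takes `(h, k)` to
`(k, x h x⁻¹)`.

Bi-quasiprimitivity says that a nontrivial normal subgroup of `G` inside `Gp` is transitive on both
parts. Applied to the product of the kernels of `Gp` on `Δ` and on `Δ'`, it shows that `Gp` is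
faithful on `Δ` (`IsHalving.eq_one_of_pair_one_mem`): otherwise all pairs in `Δ × Δ'` and in
`Δ' × Δ` would be arcs. So `Gp` is the graph of an automorphism `φ` of `H`, and conjugation by `t`
gives `φ ^ 2 = ι_x` (`IsHalving.exists_diag_eq`). Applied to `Diag_φ(S × S)`, it shows that
nontrivial `φ`-invariant normal subgroups `S` of `H` are transitive
(`IsHalving.isPretransitive_of_invariant`).

If `t` centralised `Gp`, it would be central in `G`, and `⟨t⟩` would be normal with at most two
orbits. Vertices in the same orbit have the same stabiliser, and two of the vertices of a `2`-arc are
in the same orbit, which contradicts the transitivity on `2`-arcs (`eq_one_of_central`).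

If `H` is not quasiprimitive, it has an intransitive minimal normal subgroup `R`, which is then not
`φ`-invariant, and the rest is group theory in `H` (`exists_intransitive_isMinimalNormal`).
-/

namespace BiQuasi

/-! ### Connected digraphs -/

theorem IsConnected.forall_of_forall_adj_iff {V : Type*} {Γ : Digraph V} (h : IsConnected Γ)
    {P : V → Prop} (hP : ∀ u v, Γ.Adj u v → (P u ↔ P v)) {a : V} (ha : P a) (b : V) : P b := by
  have hr := h.preconnected a b
  rw [SimpleGraph.reachable_iff_reflTransGen] at hr
  induction hr with
  | refl => exact ha
  | tail _ hbc ih =>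
    rcases hbc.2 with hbc | hbc
    · exact (hP _ _ hbc).1 ih
    · exact (hP _ _ hbc).2 ih

theorem IsConnected.exists_adj_not_iff {V : Type*} {Γ : Digraph V} (h : IsConnected Γ)
    {P : V → Prop} {a b : V} (ha : P a) (hb : ¬ P b) :
    ∃ u v, Γ.Adj u v ∧ ¬ (P u ↔ P v) := by
  by_contra! hP
  exact hb (h.forall_of_forall_adj_iff hP ha b)

/-- A connected digraph whose arcs are the pairs `(u, σ u)`, for a permutation `σ`, is a directed
cycle. -/
theorem isDirectedCycle_of_adj_iff_perm {V : Type*} [Finite V] {Γ : Digraph V}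
    (hΓ : IsOriented Γ) (hconn : IsConnected Γ) (σ : Equiv.Perm V)
    (hσ : ∀ u v, Γ.Adj u v ↔ v = σ u) : IsDirectedCycle Γ := by
  obtain ⟨b⟩ := hconn.nonempty
  have horb : ∀ v, v ∈ MulAction.orbit (Subgroup.zpowers σ) b := by
    refine hconn.forall_of_forall_adj_iff ?_ (MulAction.mem_orbit_self b)
    intro u v huv
    rw [hσ] at huv
    subst huv
    rw [MulAction.mem_orbit_symm, MulAction.mem_orbit_symm (a₁ := σ u),
      show σ u = (⟨σ, Subgroup.mem_zpowers σ⟩ : Subgroup.zpowers σ) • u from rfl,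
      MulAction.orbit_smul]
  set r := Function.minimalPeriod (σ • ·) b with hr
  let F : ZMod r → V := fun k => ((MulAction.orbitZPowersEquiv σ b).symm k : V)
  have hF : Function.Bijective F :=
    ⟨Subtype.val_injective.comp (Equiv.injective _), fun v =>
      ⟨MulAction.orbitZPowersEquiv σ b ⟨v, horb v⟩, by simp [F]⟩⟩
  have hFint : ∀ k : ℤ, F k = (σ ^ k) b := fun k =>
    congrArg Subtype.val (MulAction.orbitZPowersEquiv_symm_apply' σ b k)
  have hFsucc : ∀ k : ZMod r, F (k + 1) = σ (F k) := fun k => by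
    obtain ⟨k, rfl⟩ := ZMod.intCast_surjective k
    rw [show (k : ZMod r) + 1 = ((1 + k : ℤ) : ZMod r) by push_cast; ring, hFint, hFint,
      zpow_add, zpow_one, Equiv.Perm.mul_apply]
  have hadj : ∀ v, Γ.Adj v (σ v) := fun v => (hσ _ _).2 rfl
  have hne : ∀ v, σ v ≠ v := fun v h => hΓ v v (by simpa [h] using hadj v)
    (by simpa [h] using hadj v)
  have hne' : ∀ v, σ (σ v) ≠ v := fun v h => hΓ _ _ (hadj v) (by simpa [h] using hadj (σ v))
  have hper : (σ ^ r) b = b := by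
    simpa using (hFint (r : ℤ)).symm.trans (by simpa using hFint 0)
  refine ⟨r, ?_, (Equiv.ofBijective F hF).symm, fun u v => ?_⟩
  · have hr0 : r ≠ 0 := NeZero.ne (Function.minimalPeriod (σ • ·) b)
    by_contra! hlt
    obtain h1 | h2 : r = 1 ∨ r = 2 := by omega
    · rw [h1] at hper
      exact hne b (by simpa using hper)
    · rw [h2] at hper
      exact hne' b (by simpa [pow_two] using hper)
  · obtain ⟨k, rfl⟩ := hF.2 u
    rw [hσ, ← hFsucc, Equiv.symm_apply_eq]
    simp only [show (Equiv.ofBijective F hF).symm (F k) = k from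
      Equiv.ofBijective_symm_apply_apply F hF k, Equiv.ofBijective_apply]

theorem IsConnected.exists_adj_of_transitive {V : Type*} {Γ : Digraph V} (h : IsConnected Γ)
    {G : Subgroup (Equiv.Perm V)} (hG : G ≤ autGroup Γ) (ht : MulAction.IsPretransitive G V)
    {a b : V} (hab : a ≠ b) (v : V) : (∃ w, Γ.Adj v w) ∧ ∃ w, Γ.Adj w v := by
  obtain ⟨u, w, huw, -⟩ := h.exists_adj_not_iff (P := fun c => c = a) rfl hab.symm
  obtain ⟨g, hg⟩ := ht.exists_smul_eq u v
  obtain ⟨g', hg'⟩ := ht.exists_smul_eq w v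
  refine ⟨⟨(g : Equiv.Perm V) w, ?_⟩, ⟨(g' : Equiv.Perm V) u, ?_⟩⟩
  · rw [← hg]; exact (hG g.2 u w).2 huw
  · rw [← hg']; exact (hG g'.2 u w).2 huw

/-- In a connected vertex-transitive digraph which is not a directed cycle, all out-valencies are
at least two. -/
theorem exists_adj_ne {V : Type*} [Finite V] {Γ : Digraph V}
    (hΓ : IsOriented Γ) (hconn : IsConnected Γ) (hcyc : ¬ IsDirectedCycle Γ)
    {G : Subgroup (Equiv.Perm V)} (hG : G ≤ autGroup Γ) (ht : MulAction.IsPretransitive G V)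
    {a b : V} (hab : a ≠ b) (v w : V) : ∃ w', Γ.Adj v w' ∧ w' ≠ w := by
  by_contra! hv
  have huniq : ∀ u, ∀ c d, Γ.Adj u c → Γ.Adj u d → c = d := by
    intro u c d hc hd
    obtain ⟨g, hg⟩ := ht.exists_smul_eq u v
    apply (g : Equiv.Perm V).injective
    rw [hv (g.1 c) (by rw [← hg]; exact (hG g.2 u c).2 hc),
      hv (g.1 d) (by rw [← hg]; exact (hG g.2 u d).2 hd)]
  choose f hf using fun u => (hconn.exists_adj_of_transitive hG ht hab u).1
  have hsurj : Function.Surjective f := fun u => by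
    obtain ⟨c, hc⟩ := (hconn.exists_adj_of_transitive hG ht hab u).2
    exact ⟨c, huniq c _ _ (hf c) hc⟩
  refine hcyc (isDirectedCycle_of_adj_iff_perm hΓ hconn
    (Equiv.ofBijective f (Finite.injective_iff_bijective.1
      (Finite.injective_iff_surjective.2 hsurj))) fun u c => ⟨fun h => ?_, ?_⟩)
  · exact huniq u _ _ h (hf u)
  · rintro rfl; exact hf u

/-- If every vertex has an out-neighbour, then every `2`-arc is the beginning of an `s`-arc, so
`s`-arc-transitivity with `s ≥ 2` makes the group transitive on `2`-arcs. -/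
theorem IsArcTransitive.two_arcs {V : Type*} {Γ : Digraph V} {G : Subgroup (Equiv.Perm V)} {s : ℕ}
    (harc : IsArcTransitive Γ G s) (hs : 2 ≤ s) (hout : ∀ v, ∃ w, Γ.Adj v w)
    {v w u v' w' u' : V} (h₁ : Γ.Adj v w) (h₂ : Γ.Adj w u) (h₁' : Γ.Adj v' w')
    (h₂' : Γ.Adj w' u') : ∃ g ∈ G, g v = v' ∧ g w = w' ∧ g u = u' := by
  choose f hf using hout
  let ext (a b c : V) (i : ℕ) : V := if i = 0 then a else if i = 1 then b else f^[i - 2] c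
  have hext : ∀ a b c, Γ.Adj a b → Γ.Adj b c →
      IsArc Γ s fun i : Fin (s + 1) => ext a b c i := by
    intro a b c hab hbc i
    obtain ⟨i, hi⟩ := i
    simp only [Fin.castSucc_mk, Fin.succ_mk, ext]
    match i with
    | 0 => simpa using hab
    | 1 => simpa using hbc
    | i + 2 =>
      simp only [Nat.add_eq_zero_iff, OfNat.ofNat_ne_zero, and_false, if_false,
        Nat.add_sub_cancel, show i + 2 + 1 - 2 = i + 1 by omega, show i + 2 ≠ 1 by omega,
        show i + 2 + 1 ≠ 1 by omega, Function.iterate_succ_apply', one_ne_zero]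
      exact hf _
  obtain ⟨g, hg, hgi⟩ := harc _ _ (hext v w u h₁ h₂) (hext v' w' u' h₁' h₂')
  refine ⟨g, hg, ?_, ?_, ?_⟩
  · simpa [ext] using hgi ⟨0, by omega⟩
  · simpa [ext] using hgi ⟨1, by omega⟩
  · simpa [ext] using hgi ⟨2, by omega⟩

/-! ### Orbits -/

/-- Pigeonhole for at most two orbits. -/
theorem mem_orbit_of_numOrbits_le_two {K V : Type*} [Finite V] [Group K] [MulAction K V]
    (h : numOrbits K V ≤ 2) (a b c : V) :
    b ∈ MulAction.orbit K a ∨ c ∈ MulAction.orbit K b ∨ c ∈ MulAction.orbit K a := by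
  by_contra! hne
  have hmk : ∀ {u w : V}, w ∉ MulAction.orbit K u →
      (Quotient.mk'' u : MulAction.orbitRel.Quotient K V) ≠ Quotient.mk'' w := by
    intro u w huw he
    exact huw (MulAction.mem_orbit_symm.1 (MulAction.orbitRel_apply.1 (Quotient.eq''.1 he)))
  have : Finite (MulAction.orbitRel.Quotient K V) := Quotient.finite _
  have := Fintype.ofFinite (MulAction.orbitRel.Quotient K V)
  rw [numOrbits, Nat.card_eq_fintype_card] at h
  exact absurd (Fintype.two_lt_card_iff.2 ⟨_, _, _, hmk hne.1, hmk hne.2.2, hmk hne.2.1⟩)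
    (not_lt.2 h)

/-! ### Index two subgroups with two orbits -/

namespace HasTwoOrbits

variable {V : Type*} {K : Subgroup (Equiv.Perm V)} {Δ Δ' : Set V}

theorem symm (h : HasTwoOrbits K Δ Δ') : HasTwoOrbits K Δ' Δ :=
  ⟨h.1.symm, h.2.trans (Set.pair_comm _ _)⟩

theorem orbit_eq_or (h : HasTwoOrbits K Δ Δ') (v : V) :
    MulAction.orbit K v = Δ ∨ MulAction.orbit K v = Δ' := by
  have : MulAction.orbit K v ∈ ({Δ, Δ'} : Set (Set V)) := h.2 ▸ Set.mem_range_self v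
  simpa using this

theorem exists_orbit_eq (h : HasTwoOrbits K Δ Δ') : ∃ v, MulAction.orbit K v = Δ := by
  have : Δ ∈ Set.range fun v : V => MulAction.orbit K v := h.2 ▸ Set.mem_insert _ _
  exact this

theorem orbit_eq (h : HasTwoOrbits K Δ Δ') {v : V} (hv : v ∈ Δ) : MulAction.orbit K v = Δ := by
  obtain ⟨u, rfl⟩ := h.exists_orbit_eq
  exact MulAction.orbit_eq_iff.2 hv

theorem nonempty (h : HasTwoOrbits K Δ Δ') : Δ.Nonempty := by
  obtain ⟨u, rfl⟩ := h.exists_orbit_eq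
  exact MulAction.nonempty_orbit u

theorem mem_or_mem (h : HasTwoOrbits K Δ Δ') (v : V) : v ∈ Δ ∨ v ∈ Δ' :=
  (h.orbit_eq_or v).imp (fun hv => by rw [← hv]; exact MulAction.mem_orbit_self v)
    (fun hv => by rw [← hv]; exact MulAction.mem_orbit_self v)

theorem notMem (h : HasTwoOrbits K Δ Δ') {v : V} (hv : v ∈ Δ) : v ∉ Δ' := fun hv' =>
  h.1 ((h.orbit_eq hv).symm.trans (h.symm.orbit_eq hv'))

theorem apply_mem (h : HasTwoOrbits K Δ Δ') {k : Equiv.Perm V} (hk : k ∈ K) {v : V} (hv : v ∈ Δ) :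
    k v ∈ Δ :=
  h.orbit_eq hv ▸ MulAction.mem_orbit v (⟨k, hk⟩ : K)

theorem exists_apply_eq (h : HasTwoOrbits K Δ Δ') {v w : V} (hv : v ∈ Δ) (hw : w ∈ Δ) :
    ∃ k ∈ K, k v = w := by
  rw [← h.orbit_eq hv] at hw
  obtain ⟨⟨k, hk⟩, h⟩ := hw
  exact ⟨k, hk, h⟩

end HasTwoOrbits

/-- `G` is a transitive permutation group with a subgroup `Gp` of index two, whose orbits are
`Δ` and `Δ'`. -/
structure IsHalving {V : Type*} (G Gp : Subgroup (Equiv.Perm V)) (Δ Δ' : Set V) : Prop where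
  transitive : MulAction.IsPretransitive G V
  le : Gp ≤ G
  relIndex : Gp.relIndex G = 2
  orbits : HasTwoOrbits Gp Δ Δ'

namespace IsHalving

variable {V : Type*} {G Gp : Subgroup (Equiv.Perm V)} {Δ Δ' : Set V}

theorem symm (h : IsHalving G Gp Δ Δ') : IsHalving G Gp Δ' Δ :=
  ⟨h.transitive, h.le, h.relIndex, h.orbits.symm⟩

theorem mul_mem_iff (h : IsHalving G Gp Δ Δ') {a b : Equiv.Perm V} (ha : a ∈ G) (hb : b ∈ G) :
    a * b ∈ Gp ↔ (a ∈ Gp ↔ b ∈ Gp) :=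
  Subgroup.mul_mem_iff_of_index_two (H := Gp.subgroupOf G) h.relIndex
    (a := ⟨a, ha⟩) (b := ⟨b, hb⟩)

theorem conj_mem (h : IsHalving G Gp Δ Δ') {g k : Equiv.Perm V} (hg : g ∈ G) (hk : k ∈ Gp) :
    g * k * g⁻¹ ∈ Gp := by
  rw [h.mul_mem_iff (G.mul_mem hg (h.le hk)) (G.inv_mem hg), h.mul_mem_iff hg (h.le hk),
    inv_mem_iff]
  simp [hk]

/-- The elements outside the index two subgroup interchange its two orbits. -/
theorem apply_mem_of_notMem (h : IsHalving G Gp Δ Δ') {g : Equiv.Perm V} (hg : g ∈ G)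
    (hg' : g ∉ Gp) {v : V} (hv : v ∈ Δ) : g v ∈ Δ' := by
  obtain ⟨w, hw⟩ := h.orbits.symm.nonempty
  obtain ⟨⟨a, ha⟩, haw⟩ := h.transitive.exists_smul_eq v w
  replace haw : a v = w := haw
  have ha' : a ∉ Gp := fun hm => h.orbits.notMem (h.orbits.apply_mem hm hv) (haw ▸ hw)
  have hk : g * a⁻¹ ∈ Gp := by
    rw [h.mul_mem_iff hg (G.inv_mem ha), inv_mem_iff]
    simp [hg', ha']
  have := h.orbits.symm.apply_mem hk hw
  simpa [← haw] using this

theorem exists_notMem (h : IsHalving G Gp Δ Δ') : ∃ g ∈ G, g ∉ Gp := by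
  obtain ⟨v, hv⟩ := h.orbits.nonempty
  obtain ⟨w, hw⟩ := h.orbits.symm.nonempty
  obtain ⟨⟨a, ha⟩, haw⟩ := h.transitive.exists_smul_eq v w
  replace haw : a v = w := haw
  exact ⟨a, ha, fun hm => h.orbits.notMem (h.orbits.apply_mem hm hv) (haw ▸ hw)⟩

theorem exists_mul_mem (h : IsHalving G Gp Δ Δ') {t : Equiv.Perm V} (ht : t ∈ G) (ht' : t ∉ Gp)
    {g : Equiv.Perm V} (hg : g ∈ G) : g ∈ Gp ∨ ∃ k ∈ Gp, g = t * k := by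
  refine or_iff_not_imp_left.2 fun hg' => ⟨t⁻¹ * g, ?_, by group⟩
  rw [h.mul_mem_iff (G.inv_mem ht) hg, inv_mem_iff]
  simp [hg', ht']

/-- A nontrivial subgroup of `Gp` which is normal in the bi-quasiprimitive group `G` is transitive
on `Δ`: its at most two orbits on `V` lie inside `Δ` or `Δ'`. Normality is tested on `Gp` and on one
element `t` of `G` outside `Gp`. -/
theorem exists_apply_eq_of_normal [Finite V] (h : IsHalving G Gp Δ Δ')
    (hbq : IsBiQuasiprimitive G) {N : Subgroup (Equiv.Perm V)} (hN : N ≤ Gp) (hN' : N ≠ ⊥)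
    {t : Equiv.Perm V} (ht : t ∈ G) (ht' : t ∉ Gp) (hk : ∀ k ∈ Gp, ∀ n ∈ N, k * n * k⁻¹ ∈ N)
    (htN : ∀ n ∈ N, t * n * t⁻¹ ∈ N) {v w : V} (hv : v ∈ Δ) (hw : w ∈ Δ) : ∃ n ∈ N, n v = w := by
  have hnorm : (N.subgroupOf G).Normal := by
    refine ⟨fun n hn g => ?_⟩
    rw [Subgroup.mem_subgroupOf] at hn ⊢
    rcases h.exists_mul_mem ht ht' g.2 with hg | ⟨k, hkG, hg⟩
    · exact hk _ hg _ hn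
    · simpa [hg, mul_assoc] using htN _ (hk k hkG _ hn)
  have hbot : N.subgroupOf G ≠ ⊥ := by
    rw [Ne, Subgroup.subgroupOf_eq_bot, disjoint_of_le_iff_left_eq_bot (hN.trans h.le)]
    exact hN'
  obtain ⟨u, hu⟩ := h.orbits.symm.nonempty
  have hNo : ∀ {c d : V}, d ∈ MulAction.orbit (N.subgroupOf G) c → ∃ n ∈ N, n c = d := by
    rintro c _ ⟨⟨n, hn⟩, rfl⟩
    exact ⟨n, hn, rfl⟩
  rcases mem_orbit_of_numOrbits_le_two (hbq.le_two _ hnorm hbot) v w u with ho | ho | ho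
  · exact hNo ho
  · obtain ⟨n, hn, hnw⟩ := hNo ho
    exact (h.orbits.notMem (h.orbits.apply_mem (hN hn) hw) (hnw ▸ hu)).elim
  · obtain ⟨n, hn, hnw⟩ := hNo ho
    exact (h.orbits.notMem (h.orbits.apply_mem (hN hn) hv) (hnw ▸ hu)).elim

end IsHalving

/-! ### Permutations in terms of a labelling -/

namespace Labelling

variable {V : Type*} {Δ Δ' : Set V} (e : Labelling Δ Δ')

@[simp]
theorem pair_inl (p : Equiv.Perm Δ × Equiv.Perm Δ) (δ : Δ) :
    e.pair p (e.toEquiv (Sum.inl δ)) = e.toEquiv (Sum.inl (p.1 δ)) := by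
  simp [pair]

@[simp]
theorem pair_inr (p : Equiv.Perm Δ × Equiv.Perm Δ) (δ : Δ) :
    e.pair p (e.toEquiv (Sum.inr δ)) = e.toEquiv (Sum.inr (p.2 δ)) := by
  simp [pair]

@[simp]
theorem swap_inl (δ : Δ) : e.swap (e.toEquiv (Sum.inl δ)) = e.toEquiv (Sum.inr δ) := by
  simp [swap]

@[simp]
theorem swap_inr (δ : Δ) : e.swap (e.toEquiv (Sum.inr δ)) = e.toEquiv (Sum.inl δ) := by
  simp [swap]

theorem perm_ext {σ τ : Equiv.Perm V}
    (hl : ∀ δ, σ (e.toEquiv (Sum.inl δ)) = τ (e.toEquiv (Sum.inl δ)))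
    (hr : ∀ δ, σ (e.toEquiv (Sum.inr δ)) = τ (e.toEquiv (Sum.inr δ))) : σ = τ := by
  ext v
  obtain ⟨a | a, rfl⟩ := e.toEquiv.surjective v
  · exact hl a
  · exact hr a

theorem pair_injective : Function.Injective e.pair := fun _ _ h =>
  Equiv.Perm.sumCongrHom_injective (e.toEquiv.permCongr.injective h)

theorem inr_notMem (δ : Δ) : e.toEquiv (Sum.inr δ) ∉ Δ := fun h => by
  have := e.toEquiv.injective (e.map_inl ⟨_, h⟩)
  simp at this

theorem twistedSwap_mul_pair (x h k : Equiv.Perm Δ) :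
    e.twistedSwap x * e.pair (h, k) = e.pair (k, x * h * x⁻¹) * e.twistedSwap x := by
  apply e.perm_ext <;> intro δ <;> simp [twistedSwap]

theorem twistedSwap_conj_pair (x h k : Equiv.Perm Δ) :
    e.twistedSwap x * e.pair (h, k) * (e.twistedSwap x)⁻¹ = e.pair (k, x * h * x⁻¹) := by
  rw [twistedSwap_mul_pair, mul_inv_cancel_right]

/-- A permutation preserving `Δ` has the form `(h, k)`. -/
theorem exists_pair_eq [Finite V] {g : Equiv.Perm V} (hg : ∀ v ∈ Δ, g v ∈ Δ) :
    ∃ h k, e.pair (h, k) = g := by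
  have hmaps : Set.MapsTo (e.toEquiv.permCongr.symm g) (Set.range (Sum.inl : Δ → Δ ⊕ Δ))
      (Set.range Sum.inl) := by
    rintro _ ⟨δ, rfl⟩
    refine ⟨⟨g δ, hg δ δ.2⟩, ?_⟩
    rw [← e.toEquiv.apply_eq_iff_eq, e.map_inl]
    simp [Equiv.permCongr_def, e.map_inl]
  obtain ⟨⟨h, k⟩, hhk⟩ := Equiv.Perm.mem_sumCongrHom_range_of_perm_mapsTo_inl hmaps
  exact ⟨h, k, by rw [pair, MonoidHom.coe_mk, OneHom.coe_mk, hhk, Equiv.apply_symm_apply]⟩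

end Labelling

/-- `Δ'` is labelled by `Δ` by means of any permutation `g` interchanging the two parts. The label
`δ' = g⁻¹ δ` makes `g` send `δ'` to `δ`, as `(x, 1)(1, 2)` does. -/
theorem HasTwoOrbits.exists_labelling {V : Type*} {K : Subgroup (Equiv.Perm V)} {Δ Δ' : Set V}
    (h : HasTwoOrbits K Δ Δ') {g : Equiv.Perm V} (hg : ∀ v ∈ Δ, g v ∈ Δ')
    (hg' : ∀ v ∈ Δ', g v ∈ Δ) :
    ∃ e : Labelling Δ Δ', ∀ δ, e.toEquiv (Sum.inr δ) = g⁻¹ δ := by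
  have hinv : ∀ v ∈ Δ, g⁻¹ v ∈ Δ' := fun v hv =>
    (h.mem_or_mem _).resolve_left fun hn => h.notMem hv (by simpa using hg _ hn)
  let f : Δ ⊕ Δ → V := Sum.elim (fun δ => δ) fun δ => g⁻¹ δ
  have hf : Function.Bijective f := by
    constructor
    · refine Function.Injective.sumElim Subtype.val_injective
        (g⁻¹.injective.comp Subtype.val_injective) fun a b hab => ?_
      exact h.notMem a.2 (hab ▸ hinv b b.2)
    · intro v
      rcases h.mem_or_mem v with hv | hv
      · exact ⟨Sum.inl ⟨v, hv⟩, rfl⟩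
      · exact ⟨Sum.inr ⟨g v, hg' v hv⟩, by simp [f]⟩
  exact ⟨⟨Equiv.ofBijective f hf, fun _ => rfl, fun δ => hinv δ δ.2⟩, fun _ => rfl⟩

/-! ### The index two subgroup as a twisted diagonal -/

namespace IsHalving

variable {V : Type*} {G Gp : Subgroup (Equiv.Perm V)} {Δ Δ' : Set V}
  {e : Labelling Δ Δ'} {x : Equiv.Perm Δ}

theorem exists_twistedSwap_mem [Finite V] (h : IsHalving G Gp Δ Δ') :
    ∃ (e : Labelling Δ Δ') (x : inducedOn Gp Δ), e.twistedSwap x ∈ G := by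
  obtain ⟨g, hg, hg'⟩ := h.exists_notMem
  obtain ⟨e, he⟩ := h.orbits.exists_labelling (fun v hv => h.apply_mem_of_notMem hg hg' hv)
    (fun v hv => h.symm.apply_mem_of_notMem hg hg' hv)
  have hgg : g * g ∈ Gp := by rw [h.mul_mem_iff hg hg]
  obtain ⟨y, k, hyk⟩ := e.exists_pair_eq fun v hv => h.orbits.apply_mem hgg hv
  have hy : ∀ δ : Δ, ((y δ : Δ) : V) = (g * g) δ := fun δ => by
    rw [← hyk, ← e.map_inl, ← e.map_inl, e.pair_inl]
  refine ⟨e, ⟨y, g * g, hgg, hy⟩, ?_⟩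
  convert hg
  apply e.perm_ext <;> intro δ
  · rw [Labelling.twistedSwap, Equiv.Perm.mul_apply, e.pair_inl, e.swap_inl, he, hy, e.map_inl]
    simp
  · rw [Labelling.twistedSwap, Equiv.Perm.mul_apply, e.pair_inr, e.swap_inr, he, e.map_inl]
    simp

theorem twistedSwap_notMem (h : IsHalving G Gp Δ Δ') : e.twistedSwap x ∉ Gp := fun hm => by
  obtain ⟨v, hv⟩ := h.orbits.nonempty
  have := h.orbits.apply_mem hm hv
  rw [show v = e.toEquiv (Sum.inl ⟨v, hv⟩) from (e.map_inl ⟨v, hv⟩).symm] at this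
  exact e.inr_notMem _ (by simpa [Labelling.twistedSwap] using this)

theorem pair_conj_mem (h : IsHalving G Gp Δ Δ') (ht : e.twistedSwap x ∈ G) {a b : Equiv.Perm Δ}
    (hab : e.pair (a, b) ∈ Gp) : e.pair (b, x * a * x⁻¹) ∈ Gp := by
  rw [← e.twistedSwap_conj_pair]
  exact h.conj_mem ht hab

theorem exists_pair_eq [Finite V] (h : IsHalving G Gp Δ Δ') {k : Equiv.Perm V} (hk : k ∈ Gp) :
    ∃ a b, e.pair (a, b) = k :=
  e.exists_pair_eq fun _ hv => h.orbits.apply_mem hk hv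

theorem left_mem_inducedOn {a b : Equiv.Perm Δ} (hab : e.pair (a, b) ∈ Gp) :
    a ∈ inducedOn Gp Δ :=
  ⟨_, hab, fun δ => by rw [← e.map_inl, ← e.map_inl, e.pair_inl]⟩

theorem right_mem_inducedOn (h : IsHalving G Gp Δ Δ') (ht : e.twistedSwap x ∈ G)
    {a b : Equiv.Perm Δ} (hab : e.pair (a, b) ∈ Gp) : b ∈ inducedOn Gp Δ :=
  left_mem_inducedOn (h.pair_conj_mem ht hab)

theorem exists_pair_mem [Finite V] (h : IsHalving G Gp Δ Δ') (e : Labelling Δ Δ')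
    {a : Equiv.Perm Δ} (ha : a ∈ inducedOn Gp Δ) : ∃ b, e.pair (a, b) ∈ Gp := by
  obtain ⟨k, hk, hak⟩ := ha
  obtain ⟨c, b, rfl⟩ := h.exists_pair_eq (e := e) hk
  refine ⟨b, ?_⟩
  convert hk
  ext δ
  rw [hak, ← e.map_inl, ← e.map_inl, e.pair_inl]

theorem le_wreath [Finite V] (h : IsHalving G Gp Δ Δ') {x : inducedOn Gp Δ}
    (ht : e.twistedSwap x ∈ G) : G ≤ e.wreath (inducedOn Gp Δ) := by
  have hpair : ∀ a ∈ inducedOn Gp Δ, ∀ b ∈ inducedOn Gp Δ,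
      e.pair (a, b) ∈ e.wreath (inducedOn Gp Δ) := fun a ha b hb =>
    Subgroup.mem_sup_left (Subgroup.mem_map_of_mem _ (Subgroup.mem_prod.2 ⟨ha, hb⟩))
  have hGp : Gp ≤ e.wreath (inducedOn Gp Δ) := fun k hk => by
    obtain ⟨a, b, rfl⟩ := h.exists_pair_eq (e := e) hk
    exact hpair a (left_mem_inducedOn hk) b (h.right_mem_inducedOn ht hk)
  intro g hg
  rcases h.exists_mul_mem ht h.twistedSwap_notMem hg with hg | ⟨k, hk, rfl⟩
  · exact hGp hg
  · exact mul_mem (mul_mem (Subgroup.mem_sup_right (Subgroup.mem_zpowers _))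
      (hpair _ x.2 _ (one_mem _))) (hGp hk)

theorem isPretransitive_inducedOn (h : IsHalving G Gp Δ Δ') :
    MulAction.IsPretransitive (inducedOn Gp Δ) Δ := by
  refine ⟨fun a b => ?_⟩
  obtain ⟨k, hk, hkab⟩ := h.orbits.exists_apply_eq a.2 b.2
  have hmem : ∀ v, v ∈ Δ ↔ k v ∈ Δ := fun v => ⟨h.orbits.apply_mem hk, fun hv => by
    simpa using h.orbits.apply_mem (Gp.inv_mem hk) hv⟩
  exact ⟨⟨k.subtypePerm fun v => (hmem v).symm, k, hk, fun _ => rfl⟩, Subtype.ext hkab⟩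

/-- `Gp` acts faithfully on `Δ`. Otherwise the product of the kernels of `Gp` on the two parts is a
nontrivial normal subgroup of `G`, so the kernel on `Δ` is transitive on `Δ'`; then a vertex of `Δ`
with an out-neighbour in `Δ'` is joined to all of `Δ'`, and vice versa. -/
theorem eq_one_of_pair_one_mem [Finite V] (h : IsHalving G Gp Δ Δ') (hbq : IsBiQuasiprimitive G)
    {Γ : Digraph V} (hΓ : IsOriented Γ) (hconn : IsConnected Γ) (hG : G ≤ autGroup Γ)
    (ht : e.twistedSwap x ∈ G) {c : Equiv.Perm Δ} (hc : e.pair (1, c) ∈ Gp) : c = 1 := by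
  by_contra hc1
  let A : Subgroup (Equiv.Perm Δ) := (Gp.comap e.pair).comap (MonoidHom.inr _ _)
  let B : Subgroup (Equiv.Perm Δ) := (Gp.comap e.pair).comap (MonoidHom.inl _ _)
  have hA : ∀ {a}, a ∈ A ↔ e.pair (1, a) ∈ Gp := Iff.rfl
  have hB : ∀ {b}, b ∈ B ↔ e.pair (b, 1) ∈ Gp := Iff.rfl
  let N := (B.prod A).map e.pair
  have hN : N ≤ Gp := by
    rintro _ ⟨⟨b, a⟩, ⟨hb, ha⟩, rfl⟩
    simpa [← map_mul] using Gp.mul_mem (hB.1 hb) (hA.1 ha)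
  have hN1 : N ≠ ⊥ := by
    rw [Ne, Subgroup.eq_bot_iff_forall]
    push Not
    refine ⟨e.pair (1, c), Subgroup.mem_map_of_mem _ ⟨one_mem _, hc⟩, fun h1 => hc1 ?_⟩
    exact congrArg Prod.snd (e.pair_injective (h1.trans (map_one _).symm))
  have htrans : ∀ {v w : V}, v ∈ Δ' → w ∈ Δ' → ∃ n ∈ N, n v = w := fun hv hw => by
    refine h.symm.exists_apply_eq_of_normal hbq hN hN1 ht h.twistedSwap_notMem ?_ ?_ hv hw
    · rintro k hk _ ⟨⟨b, a⟩, ⟨hb, ha⟩, rfl⟩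
      obtain ⟨p, q, rfl⟩ := h.exists_pair_eq (e := e) hk
      refine ⟨(p * b * p⁻¹, q * a * q⁻¹), ⟨?_, ?_⟩, by simp [← map_mul, ← map_inv]⟩
      · refine hB.2 ?_
        simpa [← map_mul, ← map_inv] using Gp.mul_mem (Gp.mul_mem hk (hB.1 hb)) (Gp.inv_mem hk)
      · refine hA.2 ?_
        simpa [← map_mul, ← map_inv] using Gp.mul_mem (Gp.mul_mem hk (hA.1 ha)) (Gp.inv_mem hk)
    · rintro _ ⟨⟨b, a⟩, ⟨hb, ha⟩, rfl⟩
      rw [e.twistedSwap_conj_pair]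
      refine Subgroup.mem_map_of_mem _ ⟨?_, ?_⟩
      · refine hB.2 ?_
        simpa using h.pair_conj_mem ht (hA.1 ha)
      · exact h.pair_conj_mem ht (hB.1 hb)
  -- Some arc joins the two parts; applying an element interchanging them, it leads from `Δ` to `Δ'`.
  obtain ⟨u, hu⟩ := h.orbits.nonempty
  obtain ⟨u', hu'⟩ := h.orbits.symm.nonempty
  have hadj : ∃ v ∈ Δ, ∃ w ∈ Δ', Γ.Adj v w := by
    obtain ⟨v, w, hvw, hne⟩ := hconn.exists_adj_not_iff (P := (· ∈ Δ)) hu (h.orbits.symm.notMem hu')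
    have hΔ : ∀ z, z ∉ Δ ↔ z ∈ Δ' := fun z =>
      ⟨(h.orbits.mem_or_mem z).resolve_left, h.orbits.symm.notMem⟩
    by_cases hv : v ∈ Δ
    · exact ⟨v, hv, w, (hΔ w).1 (by tauto), hvw⟩
    · have hw : w ∈ Δ := by tauto
      exact ⟨_, h.symm.apply_mem_of_notMem ht h.twistedSwap_notMem ((hΔ v).1 hv), _,
        h.apply_mem_of_notMem ht h.twistedSwap_notMem hw, (hG ht v w).2 hvw⟩
  obtain ⟨v, hv, w, hw, hvw⟩ := hadj
  have hall : ∀ w' ∈ Δ', Γ.Adj v w' := fun w' hw' => by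
    obtain ⟨_, ⟨⟨b, a⟩, ⟨hb, ha⟩, rfl⟩, hn⟩ := htrans hw hw'
    have hv1 : e.pair (1, a) v = v := by
      rw [show v = e.toEquiv (Sum.inl ⟨v, hv⟩) from (e.map_inl ⟨v, hv⟩).symm, e.pair_inl]
      rfl
    have hw1 : e.pair (1, a) w = w' := by
      rw [← hn]
      obtain ⟨δ | δ, rfl⟩ := e.toEquiv.surjective w
      · exact (h.orbits.notMem (by rw [e.map_inl]; exact δ.2) hw).elim
      · simp
    rw [← hv1, ← hw1]
    exact (hG (h.le (hA.1 ha)) v w).2 hvw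
  have htv := h.apply_mem_of_notMem ht h.twistedSwap_notMem hv
  obtain ⟨w₀, hw₀⟩ := (e.twistedSwap x).surjective v
  have hw₀' : w₀ ∈ Δ' := (h.orbits.mem_or_mem w₀).resolve_left fun hm =>
    h.orbits.notMem hv (hw₀ ▸ h.apply_mem_of_notMem ht h.twistedSwap_notMem hm)
  have hback : Γ.Adj (e.twistedSwap x v) v := by
    have := (hG ht v w₀).2 (hall w₀ hw₀')
    rwa [hw₀] at this
  exact hΓ _ _ (hall _ htv) hback

/-- `Gp` is the graph of an automorphism `φ` of the group it induces on `Δ`; conjugation by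
`(x, 1)(1, 2)` shows that `φ ^ 2` is conjugation by `x`. -/
theorem exists_diag_eq [Finite V] (h : IsHalving G Gp Δ Δ') {x : inducedOn Gp Δ}
    (ht : e.twistedSwap x ∈ G) (hfaith : ∀ c, e.pair (1, c) ∈ Gp → c = 1) :
    ∃ φ : MulAut (inducedOn Gp Δ), Gp = e.diag φ ⊤ ∧ φ * φ = MulAut.conj x := by
  have huniq : ∀ {a b c}, e.pair (a, b) ∈ Gp → e.pair (a, c) ∈ Gp → b = c := by
    intro a b c hb hc
    have := hfaith (b⁻¹ * c) (by
      simpa [← map_mul, ← map_inv] using Gp.mul_mem (Gp.inv_mem hb) hc)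
    exact inv_mul_eq_one.1 this
  choose f hf using fun a : inducedOn Gp Δ => h.exists_pair_mem e a.2
  let ψ : inducedOn Gp Δ →* inducedOn Gp Δ :=
    MonoidHom.mk' (fun a => ⟨f a, h.right_mem_inducedOn ht (hf a)⟩) fun a b => Subtype.ext <|
      huniq (hf (a * b)) (by simpa [← map_mul] using Gp.mul_mem (hf a) (hf b))
  have hψ : ∀ a : inducedOn Gp Δ, e.pair (a, ψ a) ∈ Gp := hf
  have hψψ : ∀ a : inducedOn Gp Δ, ψ (ψ a) = x * a * x⁻¹ := fun a => Subtype.ext <|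
    huniq (hψ (ψ a)) (by simpa using h.pair_conj_mem ht (hψ a))
  have hinj : Function.Injective ψ := fun a b hab => by
    have : ψ (ψ a) = ψ (ψ b) := by rw [hab]
    simpa [hψψ] using this
  refine ⟨MulEquiv.ofBijective ψ (Finite.injective_iff_bijective.1 hinj), ?_, ?_⟩
  · ext k
    constructor
    · intro hk
      obtain ⟨a, b, rfl⟩ := h.exists_pair_eq (e := e) hk
      exact ⟨⟨a, left_mem_inducedOn hk⟩, trivial,
        congrArg (fun c => e.pair (a, c)) (huniq (hψ ⟨a, left_mem_inducedOn hk⟩) hk)⟩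
    · rintro ⟨c, -, rfl⟩
      exact hψ c
  · exact MulEquiv.ext hψψ

end IsHalving

/-! ### Minimal normal subgroups -/

theorem exists_isMinimalNormal_le {K : Type*} [Group K] [Finite K] {N : Subgroup K}
    (hN : N.Normal) (hN' : N ≠ ⊥) : ∃ R ≤ N, IsMinimalNormal R :=
  exists_minimal_le_of_wellFoundedLT (fun L : Subgroup K => L.Normal ∧ L ≠ ⊥) N ⟨hN, hN'⟩

theorem IsMinimalNormal.disjoint_or_le {K : Type*} [Group K] {R S : Subgroup K}
    (hR : IsMinimalNormal R) (hS : S.Normal) : Disjoint R S ∨ R ≤ S := by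
  refine or_iff_not_imp_left.2 fun hd => ?_
  have := hR.prop.1
  exact (hR.le_of_le ⟨inferInstance, fun hb => hd (disjoint_iff.2 hb)⟩
    (inf_le_left : R ⊓ S ≤ R)).trans inf_le_right

/-- Let `φ` be an automorphism of the transitive group `H` whose square is inner, and suppose that
all `φ`-invariant nontrivial normal subgroups of `H` are transitive. If `H` is not quasiprimitive,
it has an intransitive minimal normal subgroup `R` for which `R ⊔ R ^ φ` is a direct product, and is
minimal among the `φ`-invariant nontrivial normal subgroups. For the minimality, such a subgroup `S`
of `R ⊔ R ^ φ` either contains `R`, or it centralises `R ⊔ R ^ φ`; in the latter case, `S` being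
transitive, `R ⊔ R ^ φ` is semiregular and hence equal to `S`. -/
theorem exists_intransitive_isMinimalNormal {D : Type*} [Finite D] {H : Subgroup (Equiv.Perm D)}
    (φ : MulAut H) (x : H) (hφ : φ * φ = MulAut.conj x)
    (hT : ∀ S : Subgroup H, S.Normal → S ≠ ⊥ → (∀ s ∈ S, φ s ∈ S) → MulAction.IsPretransitive S D)
    (ht : MulAction.IsPretransitive H D) (hnq : ¬ IsQuasiprimitive H) :
    ∃ R M : Subgroup H, IsMinimalNormal R ∧ ¬ MulAction.IsPretransitive R D ∧
      R.map φ.toMonoidHom ≠ R ∧ Disjoint R (R.map φ.toMonoidHom) ∧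
      M = R ⊔ R.map φ.toMonoidHom ∧ M.map φ.toMonoidHom = M ∧ M.Normal ∧ M ≠ ⊥ ∧
      ∀ S : Subgroup H, S.Normal → S ≠ ⊥ → (∀ s ∈ S, φ s ∈ S) → S ≤ M → M ≤ S := by
  have hφφ : ∀ h, φ (φ h) = x * h * x⁻¹ := fun h => DFunLike.congr_fun hφ h
  obtain ⟨N, hN, hN', hNt⟩ : ∃ N : Subgroup H, N.Normal ∧ N ≠ ⊥ ∧
      ¬ MulAction.IsPretransitive N D := by
    by_contra! hall
    exact hnq ⟨ht, hall⟩
  obtain ⟨R, hRN, hR⟩ := exists_isMinimalNormal_le hN hN'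
  have hRnorm : R.Normal := hR.prop.1
  have hRt : ¬ MulAction.IsPretransitive R D := fun hRt => hNt ⟨fun a b => by
    obtain ⟨r, hr⟩ := hRt.exists_smul_eq a b
    exact ⟨⟨r, hRN r.2⟩, hr⟩⟩
  set Q := R.map φ.toMonoidHom with hQ
  have hφQ : ∀ r ∈ R, φ r ∈ Q := fun r hr => Subgroup.mem_map_of_mem _ hr
  have hQnorm : Q.Normal := hRnorm.map _ φ.surjective
  have hQR : Q ≠ R := fun heq => hRt (hT R hRnorm hR.prop.2 fun s hs => heq ▸ hφQ s hs)
  have hQmap : Q.map φ.toMonoidHom = R := by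
    ext r
    constructor
    · rintro ⟨_, ⟨r, hr, rfl⟩, rfl⟩
      exact (hφφ r).symm ▸ hRnorm.conj_mem r hr x
    · intro hr
      refine ⟨_, hφQ _ (hRnorm.conj_mem r hr x⁻¹), (hφφ _).trans ?_⟩
      group
  have hdisj : Disjoint R Q := (hR.disjoint_or_le hQnorm).resolve_right fun hle =>
    hQR (le_antisymm (hQmap ▸ Subgroup.map_mono hle) hle)
  refine ⟨R, R ⊔ Q, hR, hRt, hQR, hdisj, rfl, ?_, inferInstance, ?_, ?_⟩
  · rw [Subgroup.map_sup, hQmap, ← hQ, sup_comm]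
  · exact fun hb => hR.prop.2 (le_bot_iff.1 (hb ▸ le_sup_left))
  · intro S hS hS' hSφ hSM
    rcases hR.disjoint_or_le hS with hd | hle
    · have hdQ : Disjoint S Q := by
        rw [Subgroup.disjoint_def]
        rintro _ hs ⟨r, hr, rfl⟩
        have h1 : φ (φ r) = 1 := Subgroup.disjoint_def.1 hd
          ((hφφ r).symm ▸ hRnorm.conj_mem r hr x) (hSφ _ hs)
        exact (map_eq_one_iff φ φ.injective).1 h1
      have hcomm : R ⊔ Q ≤ Subgroup.centralizer (S : Set H) := by
        refine sup_le (fun r hr s hs => ?_) (fun q hq s hs => ?_)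
        · exact (Subgroup.commute_of_normal_of_disjoint R S hRnorm hS hd r s hr hs).symm
        · exact Subgroup.commute_of_normal_of_disjoint S Q hS hQnorm hdQ s q hs hq
      have hSt := hT S hS hS' hSφ
      intro m hm
      rcases isEmpty_or_nonempty D with hD | ⟨⟨d⟩⟩
      · exact (hS' (Subsingleton.elim _ _)).elim
      obtain ⟨s, hs⟩ := hSt.exists_smul_eq d (m • d)
      replace hs : (s : H) • d = m • d := hs
      suffices m = s from this ▸ s.2
      refine Subtype.ext (Equiv.ext fun a => ?_)
      obtain ⟨r, rfl⟩ := hSt.exists_smul_eq d a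
      change m • (r : H) • d = (s : H) • (r : H) • d
      rw [← mul_smul, ← mul_smul, ← hcomm hm r r.2, ← hcomm (hSM s.2) r r.2, mul_smul, mul_smul, hs]
    · exact sup_le hle (hQ ▸ by
        rintro _ ⟨r, hr, rfl⟩
        exact hSφ _ (hle hr))

/-! ### The two structural cases -/

namespace Labelling

variable {V : Type*} {Δ Δ' : Set V} (e : Labelling Δ Δ') {H : Subgroup (Equiv.Perm Δ)}

theorem diagHom_apply (φ : MulAut H) (h : H) :
    e.diagHom φ h = e.pair ((h : Equiv.Perm Δ), (φ h : Equiv.Perm Δ)) :=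
  rfl

theorem diagHom_injective (φ : MulAut H) : Function.Injective (e.diagHom φ) := fun _ _ h =>
  Subtype.ext (congrArg Prod.fst (e.pair_injective h))

theorem twistedSwap_conj_diagHom {φ : MulAut H} {x : H} (hφ : φ * φ = MulAut.conj x) (h : H) :
    e.twistedSwap x * e.diagHom φ h * (e.twistedSwap x)⁻¹ = e.diagHom φ (φ h) := by
  rw [diagHom_apply, diagHom_apply, twistedSwap_conj_pair,
    show φ (φ h) = x * h * x⁻¹ from DFunLike.congr_fun hφ h]
  rfl

end Labelling

namespace IsHalving

variable {V : Type*} {G : Subgroup (Equiv.Perm V)} {Δ Δ' : Set V}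
  {e : Labelling Δ Δ'} {H : Subgroup (Equiv.Perm Δ)} {φ : MulAut H} {x : H}

theorem isPretransitive_of_invariant [Finite V] (h : IsHalving G (e.diag φ ⊤) Δ Δ')
    (hbq : IsBiQuasiprimitive G) (ht : e.twistedSwap x ∈ G) (hφ : φ * φ = MulAut.conj x)
    {S : Subgroup H} (hS : S.Normal) (hS' : S ≠ ⊥) (hSφ : ∀ s ∈ S, φ s ∈ S) :
    MulAction.IsPretransitive S Δ := by
  refine ⟨fun a b => ?_⟩
  obtain ⟨_, ⟨s, hs, rfl⟩, hsab⟩ := h.exists_apply_eq_of_normal hbq (N := e.diag φ S)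
    (Subgroup.map_mono le_top) (fun hb => hS' ((Subgroup.map_eq_bot_iff_of_injective _
      (e.diagHom_injective φ)).1 hb)) ht h.twistedSwap_notMem
    (by
      rintro _ ⟨k, -, rfl⟩ _ ⟨s, hs, rfl⟩
      exact ⟨k * s * k⁻¹, hS.conj_mem s hs k, by simp⟩)
    (by
      rintro _ ⟨s, hs, rfl⟩
      exact ⟨φ s, hSφ s hs, (e.twistedSwap_conj_diagHom hφ s).symm⟩) a.2 b.2
  refine ⟨⟨s, hs⟩, Subtype.ext ?_⟩
  rw [← hsab, e.diagHom_apply, ← e.map_inl a, e.pair_inl, e.map_inl]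
  rfl

theorem intransitiveCase [Finite V] (h : IsHalving G (e.diag φ ⊤) Δ Δ')
    (hbq : IsBiQuasiprimitive G) (ht : e.twistedSwap x ∈ G) (hφ : φ * φ = MulAut.conj x)
    (hH : MulAction.IsPretransitive H Δ) (hnq : ¬ IsQuasiprimitive H) :
    e.IntransitiveCase G H φ := by
  have hinv : ∀ S : Subgroup H, S.Normal → S ≠ ⊥ → (∀ s ∈ S, φ s ∈ S) →
      MulAction.IsPretransitive S Δ := fun S => h.isPretransitive_of_invariant hbq ht hφ
  obtain ⟨R, M, hR, hRt, hRφ, hd, hM, hMφ, hMn, hM1, hmin⟩ :=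
    exists_intransitive_isMinimalNormal φ x hφ hinv hH hnq
  have hMφ' : ∀ s ∈ M, φ s ∈ M := fun s hs => hMφ ▸ Subgroup.mem_map_of_mem φ.toMonoidHom hs
  have hleG : ∀ K, e.diag φ K ≤ G := fun K => (Subgroup.map_mono le_top).trans h.le
  have hdiag : ∀ k : H, e.diagHom φ k ∈ G := fun k => hleG ⊤ (Subgroup.mem_map_of_mem _ trivial)
  refine ⟨R, M, hR, hRt, hRφ, hd, hM, hMφ, hinv M hMn hM1 hMφ', hleG M, ⟨⟨?_, ?_⟩, ?_⟩⟩
  · refine ⟨?_⟩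
    rintro ⟨_, _⟩ ⟨m, hm, rfl⟩ ⟨g, hg⟩
    rw [Subgroup.mem_subgroupOf]
    rcases h.exists_mul_mem ht h.twistedSwap_notMem hg with ⟨k, -, rfl⟩ | ⟨_, ⟨k, -, rfl⟩, rfl⟩
    · exact ⟨k * m * k⁻¹, hMn.conj_mem m hm k, by simp⟩
    · refine ⟨φ (k * m * k⁻¹), hMφ' _ (hMn.conj_mem m hm k), ?_⟩
      rw [← e.twistedSwap_conj_diagHom hφ]
      simp [mul_assoc]
  · rw [Ne, Subgroup.subgroupOf_eq_bot, disjoint_of_le_iff_left_eq_bot (hleG M)]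
    exact fun hb => hM1 ((Subgroup.map_eq_bot_iff_of_injective _ (e.diagHom_injective φ)).1 hb)
  · rintro L ⟨hLn, hL1⟩ hLM
    -- `L` is the twisted diagonal of `S`, which inherits normality from conjugation by `Gp`, and
    -- `φ`-invariance from conjugation by `(x, 1)(1, 2)`.
    let S : Subgroup H := (L.map G.subtype).comap (e.diagHom φ)
    have hS : ∀ {s}, s ∈ S ↔ (⟨e.diagHom φ s, hdiag s⟩ : G) ∈ L := fun {s} =>
      ⟨by rintro ⟨l, hl, hls⟩
          rwa [show (⟨e.diagHom φ s, hdiag s⟩ : G) = l from Subtype.ext hls.symm],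
        fun hs => ⟨_, hs, rfl⟩⟩
    have hLS : ∀ l ∈ L, ∃ s ∈ M, s ∈ S ∧ e.diagHom φ s = l := by
      rintro ⟨l, hl⟩ hlL
      obtain ⟨m, hm, rfl⟩ := hLM hlL
      exact ⟨m, hm, hS.2 hlL, rfl⟩
    have hMS := hmin S ?_ ?_ ?_ ?_
    · rintro ⟨_, _⟩ ⟨m, hm, rfl⟩
      exact hS.1 (hMS hm)
    · refine ⟨fun s hs k => hS.2 ?_⟩
      convert hLn.conj_mem _ (hS.1 hs) ⟨e.diagHom φ k, hdiag k⟩ using 1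
      exact Subtype.ext (by simp)
    · intro hb
      refine hL1 ((Subgroup.eq_bot_iff_forall _).2 fun l hl => ?_)
      obtain ⟨s, -, hs, hsl⟩ := hLS l hl
      rw [hb, Subgroup.mem_bot] at hs
      exact Subtype.ext (by rw [← hsl, hs, map_one]; rfl)
    · intro s hs
      rw [hS]
      convert hLn.conj_mem _ (hS.1 hs) ⟨e.twistedSwap x, ht⟩ using 1
      exact Subtype.ext (e.twistedSwap_conj_diagHom hφ s).symm
    · intro s hs
      obtain ⟨m, hm, hms⟩ := hLM (hS.1 hs)
      rwa [← e.diagHom_injective φ hms]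

end IsHalving

/-- A nontrivial central element of `G` would generate a normal subgroup with at most two orbits, so
two of the three vertices of a `2`-arc would lie in the same orbit, and the stabiliser in `G` of one
of them would fix the other. With out-valencies at least two, this contradicts transitivity on
`2`-arcs. -/
theorem eq_one_of_central {V : Type*} [Finite V] {Γ : Digraph V} {G : Subgroup (Equiv.Perm V)}
    (hbq : IsBiQuasiprimitive G) {s : ℕ} (hs : 2 ≤ s) (harc : IsArcTransitive Γ G s)
    (hout : ∀ v w, ∃ w', Γ.Adj v w' ∧ w' ≠ w) (hin : ∀ v, ∃ u, Γ.Adj u v)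
    {t : Equiv.Perm V} (ht : t ∈ G) (hcent : ∀ g ∈ G, t * g = g * t) : t = 1 := by
  by_contra ht1
  -- The stabiliser of two consecutive vertices moves each out-neighbour of the second one.
  have hmove : ∀ {v w u}, Γ.Adj v w → Γ.Adj w u → ∃ g ∈ G, g v = v ∧ g w = w ∧ g u ≠ u := by
    intro v w u hvw hwu
    obtain ⟨u', hwu', hne⟩ := hout w u
    obtain ⟨g, hg, hgv, hgw, hgu⟩ := harc.two_arcs hs
      (fun v => (hout v v).imp fun _ h => h.1) hvw hwu hvw hwu'
    exact ⟨g, hg, hgv, hgw, hgu ▸ hne⟩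
  have hmove' : ∀ {v w}, Γ.Adj v w → ∃ g ∈ G, g v = v ∧ g w ≠ w := fun {v w} hvw => by
    obtain ⟨u, huv⟩ := hin v
    obtain ⟨g, hg, -, hgv, hgw⟩ := hmove huv hvw
    exact ⟨g, hg, hgv, hgw⟩
  let z : G := ⟨t, ht⟩
  have hz : ∀ g : G, Commute g z := fun g => Subtype.ext (hcent g g.2).symm
  have hnorm : (Subgroup.zpowers z).Normal := by
    refine ⟨?_⟩
    rintro _ ⟨n, rfl⟩ g
    exact ⟨n, by simp [((hz g).zpow_right n).eq]⟩
  have hbot : Subgroup.zpowers z ≠ ⊥ := by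
    rw [Ne, Subgroup.zpowers_eq_bot]
    exact fun h => ht1 (congrArg Subtype.val h)
  have hfix : ∀ {v w}, w ∈ MulAction.orbit (Subgroup.zpowers z) v →
      ∀ g ∈ G, g v = v → g w = w := by
    rintro v _ ⟨⟨_, n, rfl⟩, rfl⟩ g hg hgv
    have := ((hz ⟨g, hg⟩).zpow_right n).eq
    change (((⟨g, hg⟩ * z ^ n : G) : Equiv.Perm V)) v = ((z ^ n : G) : Equiv.Perm V) v
    rw [this]
    change ((z ^ n : G) : Equiv.Perm V) (g v) = _
    rw [hgv]
  obtain ⟨v⟩ : Nonempty V := by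
    by_contra hV
    rw [not_nonempty_iff] at hV
    exact ht1 (Subsingleton.elim _ _)
  obtain ⟨w, hvw, -⟩ := hout v v
  obtain ⟨u, hwu, -⟩ := hout w w
  rcases mem_orbit_of_numOrbits_le_two (hbq.le_two _ hnorm hbot) v w u with ho | ho | ho
  · obtain ⟨g, hg, hgv, hgw⟩ := hmove' hvw
    exact hgw (hfix ho g hg hgv)
  · obtain ⟨g, hg, hgw, hgu⟩ := hmove' hwu
    exact hgu (hfix ho g hg hgw)
  · obtain ⟨g, hg, hgv, -, hgu⟩ := hmove hvw hwu
    exact hgu (hfix ho g hg hgv)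

end BiQuasi

theorem proposition4p1 {V : Type*} [Finite V] (Γ : Digraph V)
    (hΓ : BiQuasi.IsOriented Γ) (hconn : BiQuasi.IsConnected Γ)
    (hcyc : ¬ BiQuasi.IsDirectedCycle Γ)
    (G : Subgroup (Equiv.Perm V)) (hG : G ≤ BiQuasi.autGroup Γ)
    (hbq : BiQuasi.IsBiQuasiprimitive G)
    (s : ℕ) (hs : 2 ≤ s) (harc : BiQuasi.IsArcTransitive Γ G s)
    (Gp : Subgroup (Equiv.Perm V)) (hGp : Gp ≤ G) (hidx : Gp.relIndex G = 2)
    (Δ Δ' : Set V) (horb : BiQuasi.HasTwoOrbits Gp Δ Δ') :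
    (∃ (e : BiQuasi.Labelling Δ Δ') (x : BiQuasi.inducedOn Gp Δ),
      e.IsStandard G (BiQuasi.inducedOn Gp Δ) x) ∧
    ∀ (e : BiQuasi.Labelling Δ Δ') (x : BiQuasi.inducedOn Gp Δ),
      e.IsStandard G (BiQuasi.inducedOn Gp Δ) x →
        ∃ φ : MulAut (BiQuasi.inducedOn Gp Δ),
          Gp = e.diag φ ⊤ ∧ φ * φ = MulAut.conj x ∧
          (e.QuasiprimitiveCase Gp (BiQuasi.inducedOn Gp Δ) x ∨
            e.IntransitiveCase G (BiQuasi.inducedOn Gp Δ) φ) := by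
  have h : BiQuasi.IsHalving G Gp Δ Δ' := ⟨hbq.transitive, hGp, hidx, horb⟩
  refine ⟨?_, fun e x hstd => ?_⟩
  · obtain ⟨e, x, ht⟩ := h.exists_twistedSwap_mem
    exact ⟨e, x, h.le_wreath ht, ht⟩
  have ht := hstd.mem
  obtain ⟨φ, hdiag, hφ⟩ := h.exists_diag_eq ht fun c =>
    h.eq_one_of_pair_one_mem hbq hΓ hconn hG ht
  refine ⟨φ, hdiag, hφ, ?_⟩
  by_cases hq : BiQuasi.IsQuasiprimitive (BiQuasi.inducedOn Gp Δ)
  · refine Or.inl ⟨hq, fun hcent => ?_⟩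
    obtain ⟨v, hv⟩ := horb.nonempty
    obtain ⟨w, hw⟩ := horb.symm.nonempty
    have hvw : v ≠ w := fun hvw => horb.notMem hv (hvw ▸ hw)
    have ht1 := BiQuasi.eq_one_of_central hbq hs harc
      (BiQuasi.exists_adj_ne hΓ hconn hcyc hG hbq.transitive hvw)
      (fun u => (hconn.exists_adj_of_transitive hG hbq.transitive hvw u).2) ht fun g hg => by
        rcases h.exists_mul_mem ht h.twistedSwap_notMem hg with hg | ⟨k, hk, rfl⟩
        · exact hcent g hg
        · rw [mul_assoc, ← hcent k hk]
    exact h.twistedSwap_notMem (ht1 ▸ Gp.one_mem)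
  · refine Or.inr (BiQuasi.IsHalving.intransitiveCase (hdiag ▸ h) hbq ht hφ
      h.isPretransitive_inducedOn hq)
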